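/- Let $\mathbb H$ be the complex upper half-plane. For a positive integer $M$, let $J_{2,2}(\Gamma_0(M))$ be the complex vector space of Jacobi forms of weight $2$ and index $2$ (with trivial character) for $\Gamma_0(M)\ltimes\mathbb Z^2$, that is, of holomorphic functions $\phi:\mathbb H\times\mathbb C\to\mathbb C$ such that, with $m=2$, - $\phi|\gamma=\phi$ for all $\gamma\in\Gamma_0(M)$, where for $\gamma=\begin{pmatrix}a&b\\c&d\end{pmatrix}\in SL_2(\mathbb Z)$ $$(\phi|\gamma)(\tau,z)=(c\tau+d)^{-2}e^{-2\pi i m\frac{cz^2}{c\tau+d}}\,\phi\!\left(\frac{a\tau+b}{c\tau+d},\frac{z}{c\tau+d}\right);$$ - $e^{2\pi i m(\lambda^2\tau+2\lambda z)}\,\phi(\tau,z+\lambda\tau+\mu)=\phi(\tau,z)$ for all $\lambda,\mu\in\mathbb Z$; - for every $\gamma\in SL_2(\mathbb Z)$, the function $\phi|\gamma$ has an absolutely convergent Fourier expansion $\sum_{n,r}c(n,r)e^{2\pi i(n\tau+rz)}$ over $r\in\mathbb Z$ and rational $n$ of bounded denominator, with $c(n,r)=0$ unless $r^2\le 4mn$.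 For $\phi\in J_{2,2}(\Gamma_0(M))$ define functions on $\mathbb H$ by $$(D_0\phi)(\tau)=\phi(\tau,0),\qquad (D_2\phi)(\tau)=\left(\frac{2}{2\pi i}\frac{\partial^2\phi}{\partial z^2}-4\frac{\partial\phi}{\partial\tau}\right)(\tau,0).$$ **Theorem.** Let $N=2$ or let $N$ be an odd square-free positive integer. Then the linear map $D_0\oplus D_2:\phi\mapsto(D_0\phi,D_2\phi)$ is injective on $J_{2,2}(\Gamma_0(2N))$. -/

import Mathlib

open UpperHalfPlane CongruenceSubgroup
open scoped MatrixGroups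

noncomputable section

/-- The automorphy factor `c τ + d` of `γ = (a b; c d)`. -/
def cocycle (γ : SL(2, ℤ)) (τ : ℍ) : ℂ := (γ 1 0 : ℂ) * (τ : ℂ) + (γ 1 1 : ℂ)

/-- The weight `k`, index `m` action of `SL(2, ℤ)` on functions on `ℍ × ℂ`:
`(φ|γ)(τ, z) = (cτ + d)^(-k) e^(-2πi m c z² / (cτ + d)) φ((aτ + b)/(cτ + d), z/(cτ + d))`. -/
def jacobiSlash (k : ℤ) (m : ℕ) (γ : SL(2, ℤ)) (φ : ℍ × ℂ → ℂ) : ℍ × ℂ → ℂ := fun p =>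
  cocycle γ p.1 ^ (-k) *
    Complex.exp (-(2 * Real.pi * Complex.I * m * ((γ 1 0 : ℂ) * p.2 ^ 2 / cocycle γ p.1))) *
    φ (γ • p.1, p.2 / cocycle γ p.1)

/-- The index `m` action of `ℤ²` on functions on `ℍ × ℂ`:
`(φ|[l, u])(τ, z) = e^(2πi m (l² τ + 2 l z)) φ(τ, z + l τ + u)`. -/
def latticeSlash (m : ℕ) (l u : ℤ) (φ : ℍ × ℂ → ℂ) : ℍ × ℂ → ℂ := fun p =>
  Complex.exp (2 * Real.pi * Complex.I * m * ((l : ℂ) ^ 2 * (p.1 : ℂ) + 2 * l * p.2)) *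
    φ (p.1, p.2 + l * (p.1 : ℂ) + u)

/-- Holomorphy on `ℍ × ℂ` (jointly in both variables), as an open subset of `ℂ × ℂ`. -/
def HolomorphicHC (φ : ℍ × ℂ → ℂ) : Prop :=
  DifferentiableOn ℂ (fun p : ℂ × ℂ => φ (ofComplex p.1, p.2)) {p | 0 < p.1.im}

/-- `φ` has a Fourier expansion `φ(τ, z) = ∑ c(n, r) e^(2πi (n τ + r z))` over `r ∈ ℤ` and rational
`n` of bounded denominator, converging absolutely on all of `ℍ × ℂ`, with `c(n, r) = 0` unless
`r² ≤ 4 m n`. -/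
def HasJacobiExpansion (m : ℕ) (φ : ℍ × ℂ → ℂ) : Prop :=
  ∃ (h : ℕ) (c : ℚ × ℤ → ℂ), 0 < h ∧
    (∀ n r, c (n, r) ≠ 0 → (∃ j : ℤ, n * h = j) ∧ (r : ℚ) ^ 2 ≤ 4 * m * n) ∧
    ∀ (τ : ℍ) (z : ℂ), HasSum
      (fun p : ℚ × ℤ => c p *
        Complex.exp (2 * Real.pi * Complex.I * ((p.1 : ℂ) * (τ : ℂ) + (p.2 : ℂ) * z)))
      (φ (τ, z))

/-- Jacobi forms of weight `k` and index `m` for `Γ ⋉ ℤ²`: holomorphic functions on `ℍ × ℂ`,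
invariant under `Γ` and `ℤ²`, and holomorphic at every cusp, that is, `φ|γ` has an expansion
supported on `r² ≤ 4 m n` for every `γ ∈ SL(2, ℤ)`. -/
structure IsJacobiForm (k : ℤ) (m : ℕ) (Γ : Subgroup SL(2, ℤ)) (φ : ℍ × ℂ → ℂ) : Prop where
  holo : HolomorphicHC φ
  slash_eq : ∀ γ ∈ Γ, jacobiSlash k m γ φ = φ
  lattice_eq : ∀ l u : ℤ, latticeSlash m l u φ = φ
  cusps : ∀ γ : SL(2, ℤ), HasJacobiExpansion m (jacobiSlash k m γ φ)

theorem jacobiSlash_add (k : ℤ) (m : ℕ) (γ : SL(2, ℤ)) (φ ψ : ℍ × ℂ → ℂ) :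
    jacobiSlash k m γ (φ + ψ) = jacobiSlash k m γ φ + jacobiSlash k m γ ψ := by
  funext p; simp only [jacobiSlash, Pi.add_apply]; ring

theorem jacobiSlash_smul (k : ℤ) (m : ℕ) (γ : SL(2, ℤ)) (a : ℂ) (φ : ℍ × ℂ → ℂ) :
    jacobiSlash k m γ (a • φ) = a • jacobiSlash k m γ φ := by
  funext p; simp only [jacobiSlash, Pi.smul_apply, smul_eq_mul]; ring

theorem latticeSlash_add (m : ℕ) (l u : ℤ) (φ ψ : ℍ × ℂ → ℂ) :
    latticeSlash m l u (φ + ψ) = latticeSlash m l u φ + latticeSlash m l u ψ := by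
  funext p; simp only [latticeSlash, Pi.add_apply]; ring

theorem latticeSlash_smul (m : ℕ) (l u : ℤ) (a : ℂ) (φ : ℍ × ℂ → ℂ) :
    latticeSlash m l u (a • φ) = a • latticeSlash m l u φ := by
  funext p; simp only [latticeSlash, Pi.smul_apply, smul_eq_mul]; ring

theorem HasJacobiExpansion.add {m : ℕ} {φ ψ : ℍ × ℂ → ℂ} (hφ : HasJacobiExpansion m φ)
    (hψ : HasJacobiExpansion m ψ) : HasJacobiExpansion m (φ + ψ) := by
  obtain ⟨h, c, hh, hc, hs⟩ := hφ
  obtain ⟨h', c', hh', hc', hs'⟩ := hψ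
  refine ⟨h * h', c + c', Nat.mul_pos hh hh', fun n r hne => ?_, fun τ z => ?_⟩
  · by_cases h0 : c (n, r) = 0
    · have h1 : c' (n, r) ≠ 0 := by
        intro h1; exact hne (by simp [h0, h1])
      obtain ⟨⟨j, hj⟩, hle⟩ := hc' n r h1
      refine ⟨⟨j * h, ?_⟩, hle⟩
      push_cast
      rw [← hj]; ring
    · obtain ⟨⟨j, hj⟩, hle⟩ := hc n r h0
      refine ⟨⟨j * h', ?_⟩, hle⟩
      push_cast
      rw [← hj]; ring
  · have key := (hs τ z).add (hs' τ z)
    simp only [← add_mul] at key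
    exact key

theorem HasJacobiExpansion.smul {m : ℕ} {φ : ℍ × ℂ → ℂ} (a : ℂ) (hφ : HasJacobiExpansion m φ) :
    HasJacobiExpansion m (a • φ) := by
  obtain ⟨h, c, hh, hc, hs⟩ := hφ
  refine ⟨h, a • c, hh, fun n r hne => hc n r fun h0 => hne (by simp [h0]), fun τ z => ?_⟩
  have key := (hs τ z).mul_left a
  simp only [← mul_assoc] at key
  simpa only [Pi.smul_apply, smul_eq_mul, ← mul_assoc] using key

/-- The complex vector space `J_{k,m}(Γ)` of Jacobi forms. -/
def JacobiForms (k : ℤ) (m : ℕ) (Γ : Subgroup SL(2, ℤ)) : Submodule ℂ (ℍ × ℂ → ℂ) where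
  carrier := {φ | IsJacobiForm k m Γ φ}
  add_mem' := by
    intro φ ψ hφ hψ
    refine ⟨hφ.holo.add hψ.holo, fun γ hγ => ?_, fun l u => ?_, fun γ => ?_⟩
    · rw [jacobiSlash_add, hφ.slash_eq γ hγ, hψ.slash_eq γ hγ]
    · rw [latticeSlash_add, hφ.lattice_eq, hψ.lattice_eq]
    · rw [jacobiSlash_add]; exact (hφ.cusps γ).add (hψ.cusps γ)
  zero_mem' := by
    refine ⟨differentiableOn_const 0, fun γ _ => ?_, fun l u => ?_, fun γ => ?_⟩
    · funext p; simp [jacobiSlash]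
    · funext p; simp [latticeSlash]
    · refine ⟨1, 0, one_pos, fun n r hne => (hne rfl).elim, fun τ z => ?_⟩
      simp [jacobiSlash, hasSum_zero]
  smul_mem' := by
    intro a φ hφ
    refine ⟨hφ.holo.const_smul a, fun γ hγ => ?_, fun l u => ?_, fun γ => ?_⟩
    · rw [jacobiSlash_smul, hφ.slash_eq γ hγ]
    · rw [latticeSlash_smul, hφ.lattice_eq]
    · rw [jacobiSlash_smul]; exact (hφ.cusps γ).smul a

/-- The restriction `φ ↦ φ(τ, 0)`. -/
def restrictZero (φ : ℍ × ℂ → ℂ) : ℍ → ℂ := fun τ => φ (τ, 0)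

/-- The differential operator `(k/(2πi) ∂²/∂z² - 4 ∂/∂τ)` followed by restriction to `z = 0`. -/
def heatZero (k : ℤ) (φ : ℍ × ℂ → ℂ) : ℍ → ℂ := fun τ =>
  (k : ℂ) / (2 * Real.pi * Complex.I) * iteratedDeriv 2 (fun z : ℂ => φ (τ, z)) 0 -
    4 * deriv (fun w : ℂ => φ (ofComplex w, 0)) (τ : ℂ)

theorem HolomorphicHC.differentiable_snd {φ : ℍ × ℂ → ℂ} (hφ : HolomorphicHC φ) (τ : ℍ) :
    Differentiable ℂ (fun z : ℂ => φ (τ, z)) := by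
  have h1 : DifferentiableOn ℂ (fun z : ℂ => φ (ofComplex (τ : ℂ), z)) Set.univ :=
    hφ.comp (f := fun z : ℂ => ((τ : ℂ), z))
      (by fun_prop) (fun z _ => τ.im_pos)
  simpa [differentiableOn_univ] using h1

theorem HolomorphicHC.differentiableAt_fst {φ : ℍ × ℂ → ℂ} (hφ : HolomorphicHC φ) (τ : ℍ) :
    DifferentiableAt ℂ (fun w : ℂ => φ (ofComplex w, 0)) (τ : ℂ) := by
  have h1 : DifferentiableOn ℂ (fun w : ℂ => φ (ofComplex w, 0)) {w | 0 < w.im} :=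
    hφ.comp (f := fun w : ℂ => (w, (0 : ℂ))) (by fun_prop) (fun w hw => hw)
  exact h1.differentiableAt
    ((isOpen_lt continuous_const Complex.continuous_im).mem_nhds τ.im_pos)

/-- `D₀ : φ ↦ φ(τ, 0)` on `J_{k,m}(Γ)`. -/
def D0 (k : ℤ) (m : ℕ) (Γ : Subgroup SL(2, ℤ)) : JacobiForms k m Γ →ₗ[ℂ] (ℍ → ℂ) where
  toFun φ := restrictZero φ.1
  map_add' _ _ := rfl
  map_smul' _ _ := rfl

/-- `D₂ : φ ↦ (k/(2πi) ∂²φ/∂z² - 4 ∂φ/∂τ)(τ, 0)` on `J_{k,2}(Γ)`. -/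
def D2 (k : ℤ) (Γ : Subgroup SL(2, ℤ)) : JacobiForms k 2 Γ →ₗ[ℂ] (ℍ → ℂ) where
  toFun φ := heatZero k φ.1
  map_add' := by
    intro φ ψ
    funext τ
    have e1 : iteratedDeriv 2 (fun z : ℂ => (φ + ψ).1 (τ, z)) 0 =
        iteratedDeriv 2 (fun z : ℂ => φ.1 (τ, z)) 0 +
          iteratedDeriv 2 (fun z : ℂ => ψ.1 (τ, z)) 0 :=
      iteratedDeriv_fun_add (φ.2.holo.differentiable_snd τ).contDiff.contDiffAt
        (ψ.2.holo.differentiable_snd τ).contDiff.contDiffAt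
    have e2 : deriv (fun w : ℂ => (φ + ψ).1 (ofComplex w, 0)) (τ : ℂ) =
        deriv (fun w : ℂ => φ.1 (ofComplex w, 0)) (τ : ℂ) +
          deriv (fun w : ℂ => ψ.1 (ofComplex w, 0)) (τ : ℂ) :=
      deriv_fun_add (φ.2.holo.differentiableAt_fst τ) (ψ.2.holo.differentiableAt_fst τ)
    simp only [heatZero, Pi.add_apply]
    rw [e1, e2]; ring
  map_smul' := by
    intro a φ
    funext τ
    have e1 : iteratedDeriv 2 (fun z : ℂ => (a • φ).1 (τ, z)) 0 =
        a * iteratedDeriv 2 (fun z : ℂ => φ.1 (τ, z)) 0 :=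
      iteratedDeriv_const_mul_field a (fun z : ℂ => φ.1 (τ, z))
    have e2 : deriv (fun w : ℂ => (a • φ).1 (ofComplex w, 0)) (τ : ℂ) =
        a * deriv (fun w : ℂ => φ.1 (ofComplex w, 0)) (τ : ℂ) :=
      deriv_const_mul_field a
    simp only [heatZero, Pi.smul_apply, smul_eq_mul, RingHom.id_apply]
    rw [e1, e2]; ring

end

/-! ### Convergence, derivatives and decay of exponential series -/

section FourierSeries

open Filter Topology

variable {ι : Type*}

/-! Suppose `D0` and `D2` kill `φ`. Its Taylor coefficients in `z` at `0` of orders 0 and 2 vanish,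
and the odd ones vanish because `-1` lies in the group. The first non-zero coefficient `f`, of order
`2l` with `l ≥ 2`, would be modular of weight `2 + 2l` (`taylorCoeff_jacobiSlash`).

At every cusp `f` has order at least `l²/8` in `q`: vanishing moments remove all `c(n, r)` with `8n
< l²` (`coeff_eq_zero_of_taylorCoeff_eq_zero`). So `f^8 / Δ^(l²)` is a holomorphic modular form of
weight `16 + 16l - 12l²`. This is negative for `l ≥ 3`, forcing `f = 0`. For `l = 2` it is zero, so
the quotient is constant; at `i∞` the exponents of `f` are integers, so its order is at least 1
rather than 1/2, and the constant is 0. Hence every Taylor coefficient vanishes. -/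

theorem norm_exp_two_pi_I_mul (x : ℝ) (w : ℂ) :
    ‖Complex.exp (2 * Real.pi * Complex.I * (x * w))‖ = Real.exp (-(2 * Real.pi * x * w.im)) := by
  rw [Complex.norm_exp]
  congr 1
  simp
  ring

/-- Termwise differentiation of an everywhere convergent series `∑ aₚ e^(2πi rₚ z)`. -/
theorem hasSum_deriv_fourier {a : ι → ℂ} {r : ι → ℤ} {f : ℂ → ℂ}
    (H : ∀ z : ℂ, HasSum (fun p => a p * Complex.exp (2 * Real.pi * Complex.I * (r p * z))) (f z))
    (z : ℂ) :
    HasSum (fun p => a p * (2 * Real.pi * Complex.I * r p) *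
      Complex.exp (2 * Real.pi * Complex.I * (r p * z))) (deriv f z) := by
  set R : ℝ := |z.im| + 1 with hR
  have key := Complex.hasSum_deriv_of_summable_norm
    (F := fun p w => a p * Complex.exp (2 * Real.pi * Complex.I * (r p * w)))
    (U := {w : ℂ | |w.im| < R})
    -- On the strip `|Im w| < R` each term is bounded by its value at `iR` or at `-iR`, according to
    -- the sign of `r p`.
    (u := fun p => ‖a p * Complex.exp (2 * Real.pi * Complex.I * (r p * (R * Complex.I)))‖ +
      ‖a p * Complex.exp (2 * Real.pi * Complex.I * (r p * (-R * Complex.I)))‖) (z := z)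
    ((H _).summable.norm.add (H _).summable.norm) (fun p => by fun_prop)
    (isOpen_lt (by fun_prop) continuous_const) (fun p w hw => ?_) (by simp [hR])
  · have e1 : (fun w : ℂ => ∑' p, a p * Complex.exp (2 * Real.pi * Complex.I * (r p * w))) = f :=
      funext fun w => (H w).tsum_eq
    rw [e1] at key
    refine key.congr_fun fun p => Eq.symm ?_
    have h1 : HasDerivAt (fun w : ℂ => 2 * Real.pi * Complex.I * (r p * w))
        (2 * Real.pi * Complex.I * r p) z := by
      simpa using ((hasDerivAt_id z).const_mul (r p : ℂ)).const_mul (2 * Real.pi * Complex.I : ℂ)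
    rw [(h1.cexp.const_mul (a p)).deriv]
    ring
  · have e (w : ℂ) : ‖Complex.exp (2 * Real.pi * Complex.I * (r p * w))‖ =
        Real.exp (-(2 * Real.pi * r p * w.im)) := by
      simpa using norm_exp_two_pi_I_mul (r p : ℝ) w
    simp only [norm_mul, ← mul_add]
    refine mul_le_mul_of_nonneg_left ?_ (norm_nonneg _)
    rw [e, e, e]
    have hw' : |w.im| < R := hw
    have hb := abs_lt.mp hw'
    simp only [Complex.mul_im, Complex.ofReal_re, Complex.I_im, mul_one, Complex.ofReal_im,
      Complex.I_re, mul_zero, add_zero, Complex.neg_re, Complex.neg_im]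
    have hpi := Real.pi_pos
    rcases le_total 0 (r p : ℝ) with h0 | h0
    · refine le_trans (Real.exp_le_exp.mpr ?_) (le_add_of_nonneg_left (Real.exp_pos _).le)
      nlinarith [mul_nonneg (mul_nonneg two_pos.le hpi.le) h0]
    · refine le_trans (Real.exp_le_exp.mpr ?_) (le_add_of_nonneg_right (Real.exp_pos _).le)
      nlinarith [mul_nonneg (mul_nonneg two_pos.le hpi.le) (neg_nonneg.mpr h0)]

theorem hasSum_iteratedDeriv_fourier {a : ι → ℂ} {r : ι → ℤ} {f : ℂ → ℂ}
    (H : ∀ z : ℂ, HasSum (fun p => a p * Complex.exp (2 * Real.pi * Complex.I * (r p * z))) (f z))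
    (j : ℕ) (z : ℂ) :
    HasSum (fun p => a p * (2 * Real.pi * Complex.I * r p) ^ j *
      Complex.exp (2 * Real.pi * Complex.I * (r p * z))) (iteratedDeriv j f z) := by
  induction j generalizing z with
  | zero => simpa using H z
  | succ j ih =>
    rw [iteratedDeriv_succ]
    simpa only [pow_succ, ← mul_assoc] using hasSum_deriv_fourier ih z

/-- Decay at `i∞` of a series `∑ bₚ e^(2πi nₚ τ)` supported on `nₚ ≥ v`. -/
theorem isBigO_of_hasSum_exp {b : ι → ℂ} {n : ι → ℚ} {G : ℍ → ℂ} {v : ℝ}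
    (hn : ∀ p, b p ≠ 0 → v ≤ n p)
    (H : ∀ τ : ℍ, HasSum (fun p => b p * Complex.exp (2 * Real.pi * Complex.I * (n p * τ))) (G τ)) :
    G =O[atImInfty] fun τ => Real.exp (-(2 * Real.pi * v * τ.im)) := by
  set S : ℝ := ∑' p, ‖b p * Complex.exp (2 * Real.pi * Complex.I * (n p * (I : ℍ)))‖
  -- For `n ≥ v` and `y ≥ 1`, `n(y - 1) ≥ v(y - 1)`, so every term is at most its norm at `τ = i`
  -- times `e^(2πv) e^(-2πvy)`.
  refine Asymptotics.IsBigO.of_bound (S * Real.exp (2 * Real.pi * v)) ?_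
  filter_upwards [(atImInfty_mem _).mpr ⟨1, fun τ h => h⟩] with τ (hτ : 1 ≤ τ.im)
  have hs := (H I).summable.norm
  have e (p : ι) (τ : ℍ) : ‖Complex.exp (2 * Real.pi * Complex.I * (n p * τ))‖ =
      Real.exp (-(2 * Real.pi * n p * τ.im)) := by
    simpa using norm_exp_two_pi_I_mul (n p : ℝ) τ
  rw [← (H τ).tsum_eq, Real.norm_of_nonneg (Real.exp_pos _).le, mul_assoc S, ← Real.exp_add,
    ← tsum_mul_right]
  refine tsum_of_norm_bounded (hs.mul_right _).hasSum fun p => ?_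
  by_cases hb : b p = 0
  · simp [hb]
  rw [norm_mul, norm_mul, e, e, mul_assoc ‖b p‖, ← Real.exp_add]
  refine mul_le_mul_of_nonneg_left (Real.exp_le_exp.mpr ?_) (norm_nonneg _)
  rw [show (I : ℍ).im = 1 from I_im]
  have := hn p hb
  nlinarith [Real.pi_pos, mul_nonneg (mul_nonneg Real.two_pi_pos.le (sub_nonneg.mpr this))
    (sub_nonneg.mpr hτ)]

theorem mdifferentiable_of_hasSum_exp {b : ι → ℂ} {n : ι → ℚ} {G : ℍ → ℂ}
    (hn : ∀ p, b p ≠ 0 → 0 ≤ n p)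
    (H : ∀ τ : ℍ, HasSum (fun p => b p * Complex.exp (2 * Real.pi * Complex.I * (n p * τ))) (G τ)) :
    MDifferentiable (modelWithCornersSelf ℂ ℂ) (modelWithCornersSelf ℂ ℂ) G := by
  rw [UpperHalfPlane.mdifferentiable_iff]
  intro w₀ (hw₀ : 0 < w₀.im)
  -- As `n ≥ 0`, the terms at height above `Im w₀ / 2` are dominated by those at this point.
  set ε : ℍ := ⟨(w₀.im / 2 : ℝ) * Complex.I, by simpa using hw₀⟩ with hε
  have hεim : ε.im = w₀.im / 2 := by simp [hε, UpperHalfPlane.im]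
  have hU : IsOpen {w : ℂ | ε.im < w.im} := isOpen_lt continuous_const Complex.continuous_im
  have key := Complex.differentiableOn_tsum_of_summable_norm
    (F := fun p w => b p * Complex.exp (2 * Real.pi * Complex.I * (n p * w)))
    (U := {w : ℂ | ε.im < w.im}) (H ε).summable.norm (fun p => by fun_prop) hU (fun p w hw => by
      by_cases hb : b p = 0
      · simp [hb]
      rw [norm_mul, norm_mul]
      refine mul_le_mul_of_nonneg_left ?_ (norm_nonneg _)
      have e (w : ℂ) : ‖Complex.exp (2 * Real.pi * Complex.I * (n p * w))‖ =
          Real.exp (-(2 * Real.pi * n p * w.im)) := by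
        simpa using norm_exp_two_pi_I_mul (n p : ℝ) w
      rw [e, e]
      refine Real.exp_le_exp.mpr (neg_le_neg ?_)
      have h0 : (0 : ℝ) ≤ n p := by exact_mod_cast hn p hb
      exact mul_le_mul_of_nonneg_left (le_of_lt hw) (by positivity))
  have hmem : {w : ℂ | ε.im < w.im} ∈ 𝓝 w₀ :=
    hU.mem_nhds (show ε.im < w₀.im by rw [hεim]; linarith)
  refine ((key.differentiableAt hmem).congr_of_eventuallyEq ?_).differentiableWithinAt
  filter_upwards [hmem] with w (hw : ε.im < w.im)
  have hw0 : 0 < w.im := ε.im_pos.trans hw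
  simp only [Function.comp_apply, ofComplex_apply_of_im_pos hw0]
  exact (H ⟨w, hw0⟩).tsum_eq.symm

end FourierSeries

/-! ### Vanishing moments and Fourier coefficients -/

section Expansion

variable {m : ℕ} {ψ : ℍ × ℂ → ℂ} {h : ℕ} {c : ℚ × ℤ → ℂ}

theorem hasSum_taylorCoeff
    (hs : ∀ (τ : ℍ) (z : ℂ), HasSum (fun p : ℚ × ℤ => c p *
      Complex.exp (2 * Real.pi * Complex.I * ((p.1 : ℂ) * (τ : ℂ) + (p.2 : ℂ) * z))) (ψ (τ, z)))
    (j : ℕ) (τ : ℍ) :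
    HasSum (fun p : ℚ × ℤ => c p * (2 * Real.pi * Complex.I * p.2) ^ j *
      Complex.exp (2 * Real.pi * Complex.I * (p.1 * τ)))
      (iteratedDeriv j (fun z => ψ (τ, z)) 0) := by
  have := hasSum_iteratedDeriv_fourier (r := fun p : ℚ × ℤ => p.2) (f := fun z => ψ (τ, z))
    (a := fun p => c p * Complex.exp (2 * Real.pi * Complex.I * (p.1 * τ)))
    (fun z => by simpa only [mul_add, Complex.exp_add, mul_assoc] using hs τ z) j 0
  refine this.congr_fun fun p => Eq.symm ?_
  rw [mul_zero, mul_zero, Complex.exp_zero]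
  ring

/-- If the Taylor coefficients at `z = 0` of order less than `2k` vanish, then only exponents
`n ≥ k² / (4m)` occur: the `2k` vanishing moments kill the at most `2k - 1` coefficients `c(n, r)`
with `|r| < k`. -/
theorem coeff_eq_zero_of_taylorCoeff_eq_zero (hm : 0 < m) (hh : 0 < h)
    (hc : ∀ n r, c (n, r) ≠ 0 → (∃ j : ℤ, n * h = j) ∧ (r : ℚ) ^ 2 ≤ 4 * m * n)
    (hs : ∀ (τ : ℍ) (z : ℂ), HasSum (fun p : ℚ × ℤ => c p *
      Complex.exp (2 * Real.pi * Complex.I * ((p.1 : ℂ) * (τ : ℂ) + (p.2 : ℂ) * z))) (ψ (τ, z)))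
    {k : ℕ} (hk : ∀ j < 2 * k, ∀ τ : ℍ, iteratedDeriv j (fun z => ψ (τ, z)) 0 = 0)
    {n₀ : ℚ} (hn₀ : 4 * m * n₀ < (k : ℚ) ^ 2) (r₀ : ℤ) : c (n₀, r₀) = 0 := by
  by_contra hne
  have habs (r : ℤ) (hr : c (n₀, r) ≠ 0) : r ∈ Finset.Ioo (-(k : ℤ)) k := by
    have h1 : ((r ^ 2 : ℤ) : ℚ) < ((k ^ 2 : ℤ) : ℚ) := by
      push_cast; exact (hc _ _ hr).2.trans_lt hn₀
    have := abs_lt_of_sq_lt_sq (by exact_mod_cast h1 : r ^ 2 < (k : ℤ) ^ 2) (by positivity)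
    rw [Finset.mem_Ioo]; exact abs_lt.mp this
  have hk0 := Finset.mem_Ioo.mp (habs r₀ hne)
  set s : Finset ℤ := (Finset.Ioo (-(k : ℤ)) k).erase r₀ with hsdef
  -- `Q` vanishes at every `2πi r` with `|r| < k` except `r = r₀`; its degree is below `2k`, so the
  -- weights `Q(2πi r)` combine only vanishing moments.
  set Q : Polynomial ℂ := ∏ r ∈ s, (Polynomial.X - Polynomial.C (2 * Real.pi * Complex.I * r : ℂ))
  have hQdeg : Q.natDegree < 2 * k := by
    rw [Polynomial.natDegree_finsetProd_X_sub_C_eq_card]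
    refine (Finset.card_erase_le).trans_lt ?_
    rw [Int.card_Ioo]
    omega
  have hQ0 : Q.eval (2 * Real.pi * Complex.I * r₀ : ℂ) ≠ 0 := by
    rw [Polynomial.eval_prod, Finset.prod_ne_zero_iff]
    intro r hr
    have : (r₀ : ℂ) ≠ r := by exact_mod_cast (Finset.ne_of_mem_erase hr).symm
    simpa [sub_eq_zero] using this
  have hQz (r : ℤ) (hr : r ∈ s) : Q.eval (2 * Real.pi * Complex.I * r : ℂ) = 0 := by
    rw [Polynomial.eval_prod]
    exact Finset.prod_eq_zero hr (by simp)
  have hsum (τ : ℍ) : HasSum (fun p : ℚ × ℤ => c p * Q.eval (2 * Real.pi * Complex.I * p.2 : ℂ) *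
      Complex.exp (2 * Real.pi * Complex.I * (p.1 * τ))) 0 := by
    have := hasSum_sum (s := Finset.range (2 * k)) fun j hj =>
      (hasSum_taylorCoeff hs j τ).mul_left (Q.coeff j)
    rw [Finset.sum_eq_zero fun j hj => by rw [hk j (Finset.mem_range.mp hj), mul_zero]] at this
    refine this.congr_fun fun p => Eq.symm ?_
    rw [Polynomial.eval_eq_sum_range' hQdeg, Finset.mul_sum, Finset.sum_mul]
    exact Finset.sum_congr rfl fun j _ => by ring
  have hhQ : (h : ℚ) ≠ 0 := by exact_mod_cast hh.ne'
  -- The exponents are non-negative multiples of `1/h`, so grouping by `n = i/h` gives a power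
  -- series in `e^(2πiτ/h)`.
  set e : ℕ × ℤ → ℚ × ℤ := fun p => ((p.1 : ℚ) / h, p.2) with he
  have hinj : Function.Injective e := by
    rintro ⟨a, b⟩ ⟨a', b'⟩ hab
    simp only [he, Prod.mk.injEq, div_left_inj' hhQ, Nat.cast_inj] at hab
    simp [hab.1, hab.2]
  have hrange (p : ℚ × ℤ) (hp : c p ≠ 0) : p ∈ Set.range e := by
    obtain ⟨n, r⟩ := p
    obtain ⟨⟨j, hj⟩, hle⟩ := hc n r hp
    have hn : 0 ≤ n := nonneg_of_mul_nonneg_right ((sq_nonneg _).trans hle) (by positivity)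
    have hj0 : 0 ≤ j := by
      have : (0 : ℚ) ≤ j := by rw [← hj]; positivity
      exact_mod_cast this
    refine ⟨(j.toNat, r), ?_⟩
    have : ((j.toNat : ℕ) : ℚ) = j := by exact_mod_cast Int.toNat_of_nonneg hj0
    simp only [he, this, ← hj]
    rw [mul_div_cancel_right₀ _ hhQ]
  set A : ℕ → ℂ := fun i => ∑' r : ℤ, c ((i : ℚ) / h, r) * Q.eval (2 * Real.pi * Complex.I * r : ℂ)
  have hA (τ : ℍ) : HasSum (fun i => A i • Function.Periodic.qParam h τ ^ i) ((0 : ℍ → ℂ) τ) := by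
    have h1 := (hinj.hasSum_iff (fun p hp => by
      by_cases hcp : c p = 0
      · simp [hcp]
      · exact absurd (hrange p hcp) hp)).mpr (hsum τ)
    have h2 := h1.prod_fiberwise fun i => (h1.summable.prod_factor i).hasSum
    refine h2.congr_fun fun i => Eq.symm ?_
    simp only [Function.comp_apply, he, tsum_mul_right, smul_eq_mul, A]
    congr 1
    rw [Function.Periodic.qParam, ← Complex.exp_nat_mul]
    congr 1
    push_cast
    ring
  have hA0 (i : ℕ) : A i = 0 := by
    -- Uniqueness of `q`-expansions, applied to the zero form of level one.
    rw [ModularFormClass.qExpansion_coeff_unique (f := (0 : ModularForm 𝒮ℒ 0)) (h := (h : ℝ))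
      (c := A) (by exact_mod_cast hh)
      (by simpa using AddSubgroup.mem_zmultiples_iff.mpr ⟨(h : ℤ), by simp⟩) (by simpa using hA) i]
    simp [UpperHalfPlane.qExpansion_zero]
  obtain ⟨⟨i, r⟩, hi⟩ := hrange _ hne
  simp only [he, Prod.mk.injEq] at hi
  have h3 := hA0 i
  simp only [A, hi.1] at h3
  rw [tsum_eq_single r₀] at h3
  · exact (mul_ne_zero hne hQ0) h3
  · intro r hr
    by_cases hcr : c (n₀, r) = 0
    · simp [hcr]
    · rw [hQz r (Finset.mem_erase.mpr ⟨hr, habs r hcr⟩), mul_zero]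

end Expansion

/-! ### Taylor coefficients in the elliptic variable -/

section TaylorCoefficients

open ModularForm

/-- The `j`-th derivative of `φ(τ, ·)` at `z = 0`, as a function of `τ`. -/
noncomputable def taylorCoeff (j : ℕ) (φ : ℍ × ℂ → ℂ) : ℍ → ℂ := fun τ =>
  iteratedDeriv j (fun z : ℂ => φ (τ, z)) 0

theorem cocycle_eq_denom (γ : SL(2, ℤ)) (τ : ℍ) : cocycle γ τ = denom γ τ := by
  simp [cocycle, denom]

theorem iteratedDeriv_mul_of_forall_lt {E F : ℂ → ℂ} (hE : ContDiff ℂ ⊤ E) (hF : ContDiff ℂ ⊤ F)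
    {j : ℕ} (hv : ∀ i < j, iteratedDeriv i F 0 = 0) :
    iteratedDeriv j (fun z => E z * F z) 0 = E 0 * iteratedDeriv j F 0 := by
  rw [iteratedDeriv_fun_mul (hE.contDiffAt.of_le le_top) (hF.contDiffAt.of_le le_top),
    Finset.sum_eq_single 0]
  · simp
  · intro i hi h0
    rw [hv (j - i) (by have := Finset.mem_range.mp hi; omega), mul_zero]
  · simp

/-- By Leibniz, derivatives falling on the exponential factor multiply lower Taylor coefficients,
which vanish. Rescaling `z` by `(cτ + d)⁻¹` raises the weight by `j`. -/
theorem taylorCoeff_jacobiSlash {φ : ℍ × ℂ → ℂ} (hφ : HolomorphicHC φ) (k : ℤ) (m : ℕ)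
    (γ : SL(2, ℤ)) {j : ℕ} (hv : ∀ i < j, taylorCoeff i φ = 0) :
    taylorCoeff j (jacobiSlash k m γ φ) = taylorCoeff j φ ∣[k + j] γ := by
  funext τ
  have hd : denom γ τ ≠ 0 := denom_ne_zero γ τ
  set f : ℂ → ℂ := fun z => φ (γ • τ, z)
  have hf : ContDiff ℂ ⊤ f := (hφ.differentiable_snd (γ • τ)).contDiff
  have hF (i : ℕ) : iteratedDeriv i (fun z => f ((denom γ τ)⁻¹ * z)) 0 =
      (denom γ τ)⁻¹ ^ i * taylorCoeff i φ (γ • τ) := by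
    rw [iteratedDeriv_comp_const_mul (hf.of_le le_top)]
    simp [taylorCoeff, f]
  have e : (fun z : ℂ => jacobiSlash k m γ φ (τ, z)) = fun z =>
      (denom γ τ ^ (-k) * Complex.exp (-(2 * Real.pi * Complex.I * m *
        ((γ 1 0 : ℂ) * z ^ 2 * (denom γ τ)⁻¹)))) * f ((denom γ τ)⁻¹ * z) := by
    funext z
    simp only [jacobiSlash, cocycle_eq_denom, f, div_eq_mul_inv, mul_comm z]
  rw [taylorCoeff, e, iteratedDeriv_mul_of_forall_lt (by fun_prop) (by fun_prop) fun i hi => by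
    rw [hF, hv i hi, Pi.zero_apply, mul_zero], hF, SL_slash_apply, neg_add,
    zpow_add₀ hd, zpow_neg _ (j : ℤ), zpow_natCast]
  simp
  ring

theorem taylorCoeff_eq_zero_of_odd {φ : ℍ × ℂ → ℂ} (hφ : ∀ τ z, φ (τ, -z) = φ (τ, z)) {j : ℕ}
    (hj : Odd j) : taylorCoeff j φ = 0 := by
  funext τ
  have h1 := iteratedDeriv_comp_neg j (fun z => φ (τ, z)) 0
  simp only [hφ, hj.neg_one_pow, neg_zero, smul_eq_mul, neg_one_mul] at h1
  exact self_eq_neg.mp h1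

theorem eq_zero_of_forall_taylorCoeff_eq_zero {φ : ℍ × ℂ → ℂ} (hφ : HolomorphicHC φ)
    (h : ∀ j, taylorCoeff j φ = 0) : φ = 0 := by
  funext ⟨τ, z⟩
  have := Complex.taylorSeries_eq_of_entire' 0 z (hφ.differentiable_snd τ)
  rw [← this]
  have h' (j : ℕ) : iteratedDeriv j (fun z => φ (τ, z)) 0 = 0 := congrFun (h j) τ
  simp [h']

/-- Behaviour at a cusp of the first non-vanishing Taylor coefficient. -/
theorem HasJacobiExpansion.isBigO_taylorCoeff {m : ℕ} (hm : 0 < m) {ψ : ℍ × ℂ → ℂ}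
    (hψ : HasJacobiExpansion m ψ) {k : ℕ} (hv : ∀ i < 2 * k, taylorCoeff i ψ = 0) :
    taylorCoeff (2 * k) ψ =O[atImInfty]
      fun τ => Real.exp (-(2 * Real.pi * ((k : ℝ) ^ 2 / (4 * m)) * τ.im)) := by
  obtain ⟨h, c, hh, hc, hs⟩ := hψ
  refine isBigO_of_hasSum_exp (n := Prod.fst) (fun p hp => ?_) (hasSum_taylorCoeff hs (2 * k))
  by_contra! hlt
  refine hp ?_
  rw [lt_div_iff₀ (by positivity)] at hlt
  rw [coeff_eq_zero_of_taylorCoeff_eq_zero hm hh hc hs (fun j hj τ => congrFun (hv j hj) τ)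
    (n₀ := p.1) (by rw [mul_comm]; exact_mod_cast hlt) p.2, zero_mul]

theorem HasJacobiExpansion.mdifferentiable_taylorCoeff {m : ℕ} (hm : 0 < m) {ψ : ℍ × ℂ → ℂ}
    (hψ : HasJacobiExpansion m ψ) (j : ℕ) :
    MDifferentiable (modelWithCornersSelf ℂ ℂ) (modelWithCornersSelf ℂ ℂ) (taylorCoeff j ψ) := by
  obtain ⟨h, c, hh, hc, hs⟩ := hψ
  refine mdifferentiable_of_hasSum_exp (n := Prod.fst) (fun p hp => ?_) (hasSum_taylorCoeff hs j)
  have hle := (hc p.1 p.2 (left_ne_zero_of_mul hp)).2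
  exact nonneg_of_mul_nonneg_right ((sq_nonneg _).trans hle) (by positivity)

end TaylorCoefficients

/-! ### Comparing powers of a modular form with powers of Δ -/

section Valence

open ModularForm Filter Topology

variable {Γ : Subgroup SL(2, ℤ)} {w : ℤ} {f : ℍ → ℂ} {a b : ℕ}

theorem discriminant_smul (γ : SL(2, ℤ)) (τ : ℍ) :
    discriminant (γ • τ) = denom γ τ ^ 12 * discriminant τ := by
  have h : (discriminant ∣[(12 : ℤ)] γ) τ = discriminant τ :=
    congrFun (CuspForm.discriminant.slash_action_eq' _ ⟨γ, rfl⟩) τ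
  rw [SL_slash_apply, zpow_neg] at h
  rw [← h]
  have := denom_ne_zero γ τ
  field_simp

/-- Since Δ is invariant under all of `SL(2, ℤ)`, growth at every cusp reduces to that of `f ∣[w]
γ`. -/
theorem pow_div_discriminant_slash (γ : SL(2, ℤ)) :
    (fun τ => f τ ^ a / discriminant τ ^ b) ∣[a * w - 12 * b] γ =
      fun τ => (f ∣[w] γ) τ ^ a / discriminant τ ^ b := by
  funext τ
  have hd : denom γ τ ≠ 0 := denom_ne_zero γ τ
  have hΔ := discriminant_ne_zero τ
  have e : denom γ τ ^ (-(a * w - 12 * b : ℤ)) = (denom γ τ ^ (-w)) ^ a * (denom γ τ ^ 12) ^ b := by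
    rw [← zpow_natCast, ← zpow_mul, ← pow_mul, ← zpow_natCast, ← zpow_add₀ hd]
    congr 1
    push_cast
    ring
  rw [SL_slash_apply, SL_slash_apply, discriminant_smul, e, mul_pow, mul_pow]
  field_simp

/-- If `f` is modular of weight `w` and `(f|γ)^a = O(Δ^b)` for all `γ`, then `f^a / Δ^b` is a
modular form. -/
noncomputable def powDivDiscriminant [Γ.FiniteIndex]
    (hf : MDifferentiable (modelWithCornersSelf ℂ ℂ) (modelWithCornersSelf ℂ ℂ) f)
    (hslash : ∀ γ ∈ Γ, f ∣[w] γ = f)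
    (hbd : ∀ γ : SL(2, ℤ), (fun τ => (f ∣[w] γ) τ ^ a) =O[atImInfty] fun τ => discriminant τ ^ b) :
    ModularForm (Γ : Subgroup (GL (Fin 2) ℝ)) (a * w - 12 * b) where
  toFun τ := f τ ^ a / discriminant τ ^ b
  slash_action_eq' := by
    rintro _ ⟨γ, hγ, rfl⟩
    have := pow_div_discriminant_slash (w := w) (f := f) (a := a) (b := b) γ
    rw [hslash γ hγ] at this
    exact this
  holo' := by
    rw [UpperHalfPlane.mdifferentiable_iff] at hf ⊢
    have h2 := UpperHalfPlane.mdifferentiable_iff.mp CuspForm.discriminant.holo'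
    exact (hf.pow a).div (h2.pow b) fun z _ => pow_ne_zero b (discriminant_ne_zero _)
  bdd_at_cusps' {c} hc := by
    rw [Subgroup.IsArithmetic.isCusp_iff_isCusp_SL2Z] at hc
    rw [OnePoint.isBoundedAt_iff_forall_SL2Z hc]
    intro γ _
    rw [pow_div_discriminant_slash]
    have := (hbd γ).mul (Asymptotics.isBigO_refl (fun τ => (discriminant τ ^ b)⁻¹) atImInfty)
    have h1 : (fun τ => (f ∣[w] γ) τ ^ a / discriminant τ ^ b) =O[atImInfty] (1 : ℍ → ℝ) := by
      refine (this.congr (fun τ => (div_eq_mul_inv _ _).symm) fun τ => ?_).trans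
        (Asymptotics.isBigO_const_const (1 : ℂ) (one_ne_zero (α := ℝ)) _)
      simp [discriminant_ne_zero]
    exact h1

theorem eq_zero_of_isBigO_discriminant [Γ.FiniteIndex]
    (hf : MDifferentiable (modelWithCornersSelf ℂ ℂ) (modelWithCornersSelf ℂ ℂ) f)
    (hslash : ∀ γ ∈ Γ, f ∣[w] γ = f)
    (hbd : ∀ γ : SL(2, ℤ), (fun τ => (f ∣[w] γ) τ ^ a) =O[atImInfty] fun τ => discriminant τ ^ b)
    (hw : a * w < 12 * b) : f = 0 := by
  have h0 := ModularForm.isZero_of_neg_weight (by omega) (powDivDiscriminant hf hslash hbd)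
  funext τ
  have h1 : f τ ^ a / discriminant τ ^ b = 0 := DFunLike.congr_fun h0 τ
  simpa using eq_zero_of_pow_eq_zero
    ((div_eq_zero_iff.mp h1).resolve_right (pow_ne_zero b (discriminant_ne_zero τ)))

/-- In the extremal weight, vanishing of `f^a / Δ^b` at `i∞` still forces `f = 0`. -/
theorem eq_zero_of_isLittleO_discriminant [Γ.FiniteIndex]
    (hf : MDifferentiable (modelWithCornersSelf ℂ ℂ) (modelWithCornersSelf ℂ ℂ) f)
    (hslash : ∀ γ ∈ Γ, f ∣[w] γ = f)
    (hbd : ∀ γ : SL(2, ℤ), (fun τ => (f ∣[w] γ) τ ^ a) =O[atImInfty] fun τ => discriminant τ ^ b)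
    (hw : a * w = 12 * b)
    (hinf : (fun τ => f τ ^ a) =o[atImInfty] fun τ => discriminant τ ^ b) : f = 0 := by
  obtain ⟨g, hg⟩ : ∃ g : ModularForm (Γ : Subgroup (GL (Fin 2) ℝ)) 0,
      ∀ τ, g τ = f τ ^ a / discriminant τ ^ b := by
    have h0 : (a * w - 12 * b : ℤ) = 0 := by omega
    exact ⟨ModularForm.mcast h0 (powDivDiscriminant hf hslash hbd), fun τ => rfl⟩
  obtain ⟨C, hC⟩ := ModularForm.eq_const_of_weight_zero g
  have hlim : Tendsto (fun τ : ℍ => g τ) atImInfty (𝓝 0) := by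
    simpa only [hg] using hinf.tendsto_div_nhds_zero
  have hC0 : C = 0 := by
    rw [hC] at hlim
    exact tendsto_nhds_unique tendsto_const_nhds hlim
  funext τ
  have h1 : f τ ^ a / discriminant τ ^ b = 0 := by rw [← hg, hC, hC0]; rfl
  simpa using eq_zero_of_pow_eq_zero
    ((div_eq_zero_iff.mp h1).resolve_right (pow_ne_zero b (discriminant_ne_zero τ)))

end Valence

/-! ### Vanishing of all Taylor coefficients -/

section Main

open ModularForm Filter Topology

theorem exp_pow_isBigO_discriminant_pow (x : ℝ) (a b : ℕ) (hab : a * x = b) :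
    (fun τ : ℍ => Real.exp (-(2 * Real.pi * x * τ.im)) ^ a) =O[atImInfty]
      fun τ => discriminant τ ^ b := by
  refine (exp_isBigO_discriminant.pow b).congr_left fun τ => ?_
  rw [← Real.exp_nat_mul, ← Real.exp_nat_mul]
  congr 1
  rw [← hab]
  ring

theorem tendsto_exp_neg_im_atImInfty {x : ℝ} (hx : 0 < x) :
    Tendsto (fun τ : ℍ => Real.exp (-(2 * Real.pi * x * τ.im))) atImInfty (𝓝 0) :=
  Real.tendsto_exp_neg_atTop_nhds_zero.comp
    (tendsto_comap.const_mul_atTop (by positivity : 0 < 2 * Real.pi * x))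

/-- The cusp `i∞` of `Gamma0 N` has width 1, which makes the exponents there integral in the
extremal case. -/
theorem periodic_of_slash_Gamma0 {N : ℕ} {w : ℤ} {f : ℍ → ℂ}
    (hslash : ∀ γ ∈ Gamma0 N, f ∣[w] γ = f) :
    Function.Periodic (f ∘ ofComplex) (1 : ℝ) :=
  SlashInvariantFormClass.periodic_comp_ofComplex
    (Γ := (Gamma0 N : Subgroup (GL (Fin 2) ℝ))) (k := w)
    ({ toFun := f
       slash_action_eq' := by
        rintro _ ⟨γ, hγ, rfl⟩
        exact hslash γ hγ } : SlashInvariantForm (Gamma0 N : Subgroup (GL (Fin 2) ℝ)) w)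
    (by simp)

variable {Γ : Subgroup SL(2, ℤ)} {φ : ℍ × ℂ → ℂ}

/-- The slashed coefficient is the corresponding coefficient of `φ|γ`, whose lower ones vanish too,
so the Jacobi expansion at that cusp applies. -/
theorem IsJacobiForm.taylorCoeff_isBigO {k : ℤ} {m : ℕ} (hm : 0 < m) (hφ : IsJacobiForm k m Γ φ)
    {l : ℕ} (hv : ∀ i < 2 * l, taylorCoeff i φ = 0) (γ : SL(2, ℤ)) :
    (taylorCoeff (2 * l) φ ∣[k + (2 * l : ℕ)] γ) =O[atImInfty]
      fun τ => Real.exp (-(2 * Real.pi * ((l : ℝ) ^ 2 / (4 * m)) * τ.im)) := by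
  rw [← taylorCoeff_jacobiSlash hφ.holo k m γ hv]
  refine (hφ.cusps γ).isBigO_taylorCoeff hm fun i hi => ?_
  rw [taylorCoeff_jacobiSlash hφ.holo k m γ fun i' hi' => hv i' (hi'.trans hi), hv i hi]
  exact SlashAction.zero_slash _ _

theorem IsJacobiForm.taylorCoeff_slash {k : ℤ} {m : ℕ} (hφ : IsJacobiForm k m Γ φ)
    {j : ℕ} (hv : ∀ i < j, taylorCoeff i φ = 0) (γ : SL(2, ℤ)) (hγ : γ ∈ Γ) :
    taylorCoeff j φ ∣[k + j] γ = taylorCoeff j φ := by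
  rw [← taylorCoeff_jacobiSlash hφ.holo k m γ hv, hφ.slash_eq γ hγ]

theorem jacobiSlash_one (k : ℤ) (m : ℕ) (φ : ℍ × ℂ → ℂ) : jacobiSlash k m 1 φ = φ := by
  funext p
  simp [jacobiSlash, cocycle]

theorem IsJacobiForm.mdifferentiable_taylorCoeff {k : ℤ} {m : ℕ} (hm : 0 < m)
    (hφ : IsJacobiForm k m Γ φ) (j : ℕ) :
    MDifferentiable (modelWithCornersSelf ℂ ℂ) (modelWithCornersSelf ℂ ℂ) (taylorCoeff j φ) := by
  have h := (hφ.cusps 1).mdifferentiable_taylorCoeff hm j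
  rwa [jacobiSlash_one] at h

theorem IsJacobiForm.even {m : ℕ} (hφ : IsJacobiForm 2 m Γ φ) (hΓ : -1 ∈ Γ) (τ : ℍ) (z : ℂ) :
    φ (τ, -z) = φ (τ, z) := by
  have h := congrFun (hφ.slash_eq (-1) hΓ) (τ, z)
  simpa [jacobiSlash, cocycle, div_neg] using h

/-- The `τ`-derivative drops out because `φ(τ, 0)` vanishes identically. -/
theorem taylorCoeff_two_eq_zero (hφ0 : restrictZero φ = 0) {k : ℤ} (hk : k ≠ 0)
    (hφ2 : heatZero k φ = 0) : taylorCoeff 2 φ = 0 := by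
  funext τ
  have h2 := congrFun hφ2 τ
  have e : (fun w : ℂ => φ (ofComplex w, 0)) = fun _ => 0 :=
    funext fun w => congrFun hφ0 (ofComplex w)
  simpa [taylorCoeff, heatZero, e, hk] using h2

/-- The inductive step: the weight `2 + 2l` is at most `12 · l² / 8` for `l ≥ 2`, with equality
only for `l = 2`, where the expansion at `i∞` in integral powers of `q` gains a half. -/
theorem IsJacobiForm.taylorCoeff_eq_zero {N : ℕ} [NeZero N]
    (hφ : IsJacobiForm 2 2 (Gamma0 N) φ) {l : ℕ} (hl : 2 ≤ l)
    (hv : ∀ i < 2 * l, taylorCoeff i φ = 0) : taylorCoeff (2 * l) φ = 0 := by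
  have hdiff := hφ.mdifferentiable_taylorCoeff two_pos (2 * l)
  have hslash := hφ.taylorCoeff_slash hv
  have hO := hφ.taylorCoeff_isBigO two_pos hv
  -- The power 8 clears the denominator of the order `l²/8`.
  have hbd (γ : SL(2, ℤ)) : (fun τ => (taylorCoeff (2 * l) φ ∣[(2 : ℤ) + (2 * l : ℕ)] γ) τ ^ 8)
      =O[atImInfty] fun τ => discriminant τ ^ (l ^ 2) :=
    ((hO γ).pow 8).trans (exp_pow_isBigO_discriminant_pow _ 8 (l ^ 2) (by push_cast; ring))
  rcases hl.eq_or_lt with rfl | hl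
  · refine eq_zero_of_isLittleO_discriminant hdiff hslash hbd (by norm_num) ?_
    have h1 := hO 1
    rw [SlashAction.slash_one] at h1
    have hzero : IsZeroAtImInfty (taylorCoeff (2 * 2) φ) :=
      h1.trans_tendsto (tendsto_exp_neg_im_atImInfty (by norm_num))
    -- Vanishing at `i∞` together with period 1 improves the decay from `e^(-πy)` to `e^(-2πy)`.
    have hdec := hzero.exp_decay_atImInfty one_pos (periodic_of_slash_Gamma0 hslash) hdiff
      (hzero.isBigO_one ℝ)
    refine ((hdec.pow 8).trans_isLittleO ?_).trans_isBigO
      (exp_pow_isBigO_discriminant_pow (1 / 2) 8 (2 ^ 2) (by norm_num))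
    refine Asymptotics.IsLittleO.pow ?_ (by norm_num)
    rw [Asymptotics.isLittleO_iff_tendsto fun τ h => absurd h (Real.exp_pos _).ne']
    refine (tendsto_exp_neg_im_atImInfty (x := 1 / 2) (by norm_num)).congr fun τ => ?_
    rw [← Real.exp_sub]
    congr 1
    ring
  -- `8(2 + 2l) < 12l²` for `l ≥ 3`.
  · exact eq_zero_of_isBigO_discriminant hdiff hslash hbd (by push_cast; nlinarith)

theorem IsJacobiForm.eq_zero_of_restrictZero_of_heatZero {N : ℕ} [NeZero N]
    (hφ : IsJacobiForm 2 2 (Gamma0 N) φ) (hφ0 : restrictZero φ = 0) (hφ2 : heatZero 2 φ = 0) :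
    φ = 0 := by
  have hodd {j : ℕ} (hj : Odd j) : taylorCoeff j φ = 0 :=
    taylorCoeff_eq_zero_of_odd (hφ.even (by simp [Gamma0_mem])) hj
  refine eq_zero_of_forall_taylorCoeff_eq_zero hφ.holo fun j => ?_
  induction j using Nat.strong_induction_on with
  | _ j ih =>
    obtain ⟨l, rfl | rfl⟩ := j.even_or_odd'
    · match l, ih with
      | 0, _ =>
        funext τ
        simpa [taylorCoeff, restrictZero] using congrFun hφ0 τ
      | 1, _ => exact taylorCoeff_two_eq_zero hφ0 two_ne_zero hφ2
      | l + 2, ih => exact hφ.taylorCoeff_eq_zero (by omega) ih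
    · exact hodd ⟨l, rfl⟩

end Main

theorem theorem3p4 (N : ℕ) (hN : N = 2 ∨ (Odd N ∧ Squarefree N)) :
    Function.Injective
      (LinearMap.prod (D0 2 2 (Gamma0 (2 * N))) (D2 2 (Gamma0 (2 * N)))) := by
  have hN0 : N ≠ 0 := by
    rcases hN with rfl | ⟨-, h⟩
    exacts [two_ne_zero, h.ne_zero]
  have : NeZero (2 * N) := ⟨by omega⟩
  refine (injective_iff_map_eq_zero _).mpr fun φ h => Subtype.ext ?_
  obtain ⟨h0, h2⟩ := Prod.mk.inj h
  exact IsJacobiForm.eq_zero_of_restrictZero_of_heatZero φ.2 h0 h2
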